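/- Let $\mathbb{S}^1=\mathbb{R}/\mathbb{Z}$ and let $\mathscr{S}'(\mathbb{S}^1)$ be the space of (complex) distributions on $\mathbb{S}^1$, i.e. the topological dual of $C^\infty(\mathbb{S}^1)$. For $f\in\mathscr{S}'(\mathbb{S}^1)$ put $\widehat f(n)=\langle f,e^{-2\pi i n x}\rangle$, $n\in\mathbb{Z}$, and let $f^{\mathrm{PER}}\in\mathscr{S}'(\mathbb{R})$ be the $1$-periodic extension of $f$, i.e. $\langle f^{\mathrm{PER}},\psi\rangle=\langle f,\sum_{n\in\mathbb{Z}}\psi(\cdot+n)\rangle$ for $\psi\in\mathscr{S}(\mathbb{R})$. Let $\varphi_0\in\mathscr{S}(\mathbb{R})$ be real valued with $\varphi_0(x)=1$ for $|x|\le 1$ and $\varphi_0(x)=0$ for $|x|\ge 3/2$, and let $\varphi_j(x)=\varphi_0(2^{-j}x)-\varphi_0(2^{-j+1}x)$ for $j\ge 1$. For $s\in\mathbb{R}$, $F\in\mathscr{S}'(\mathbb{R})$ and $f\in\mathscr{S}'(\mathbb{S}^1)$ define, with values in $[0,\infty]$, $$\|F\|_{\infty,\infty,s}=\sup_{j\ge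 0}2^{js}\operatorname*{ess\,sup}_{x\in\mathbb{R}}\bigl|(\varphi_j\widehat F)^{\vee}(x)\bigr|,\qquad \|f\|_{\infty,\infty,s}=\sup_{j\ge 0}2^{js}\operatorname*{ess\,sup}_{x\in\mathbb{R}}\Bigl|\sum_{n\in\mathbb{Z}}\varphi_j(n)\widehat f(n)e^{2\pi i n x}\Bigr|,$$ where $\widehat{\ }$ is the Fourier transform on $\mathscr{S}'(\mathbb{R})$ that extends $\widehat\psi(\xi)=\int_{\mathbb{R}}\psi(x)e^{-2\pi i x\xi}\,dx$, ${}^\vee$ is its inverse, and the essential supremum of a distribution that is not an $L^\infty$ function is $\infty$. Let $\mathscr{B}^s_{\infty,\infty}(\mathbb{R})$ and $\mathscr{B}^s_{\infty,\infty}(\mathbb{S}^1)$ be the sets of those $F$, respectively $f$, for which the quasi-norm is finite. Then, for every such $\varphi_0$, every $s\in\mathbb{R}$ and every $f\in\mathscr{S}'(\mathbb{S}^1)$, $$\|f^{\mathrm{PER}}\|_{\infty,\infty,s}=\|f\|_{\infty,\infty,s};$$ in particular, $f^{\mathrm{PER}}\in\mathscr{B}^s_{\infty,\infty}(\mathbb{R})$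 if and only if $f\in\mathscr{B}^s_{\infty,\infty}(\mathbb{S}^1)$. -/

import Mathlib

open scoped SchwartzMap FourierTransform ContDiff ENNReal
open MeasureTheory

/-! ### Distributions on the circle `𝕊¹ = ℝ / ℤ` -/

/-- The smooth functions on the circle `ℝ / ℤ`: the functions `g` on `ℝ / ℤ` such that
`x ↦ g (x mod 1)` is infinitely differentiable on `ℝ`. -/
def smoothCircleSubmodule : Submodule ℂ (UnitAddCircle → ℂ) where
  carrier := {g | ContDiff ℝ ∞ (fun x : ℝ ↦ g (x : UnitAddCircle))}
  add_mem' {g h} hg hh := by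
    change ContDiff ℝ ∞ fun x : ℝ ↦ g (x : UnitAddCircle) + h (x : UnitAddCircle)
    exact ContDiff.add hg hh
  zero_mem' := by
    change ContDiff ℝ ∞ fun _ : ℝ ↦ (0 : ℂ)
    exact contDiff_const
  smul_mem' c g hg := by
    change ContDiff ℝ ∞ fun x : ℝ ↦ c • g (x : UnitAddCircle)
    exact ContDiff.const_smul c hg

/-- The space `C^∞(𝕊¹)` of test functions on the circle. -/
def SmoothCircle : Type := smoothCircleSubmodule

theorem contDiff_fourier (n : ℤ) : ContDiff ℝ ∞ fun x : ℝ ↦ fourier n (x : UnitAddCircle) := by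
  simp only [fourier_coe_apply]
  have h : ContDiff ℝ ∞ fun x : ℝ ↦ (x : ℂ) := Complex.ofRealCLM.contDiff
  fun_prop

namespace SmoothCircle

noncomputable instance : AddCommGroup SmoothCircle :=
  inferInstanceAs (AddCommGroup smoothCircleSubmodule)

noncomputable instance : Module ℂ SmoothCircle :=
  inferInstanceAs (Module ℂ smoothCircleSubmodule)

instance : CoeFun SmoothCircle (fun _ ↦ UnitAddCircle → ℂ) := ⟨fun g ↦ g.1⟩

theorem ext_fun {g h : SmoothCircle} (H : ∀ x : ℝ, g x = h x) : g = h := by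
  apply Subtype.ext
  funext z
  induction z using QuotientAddGroup.induction_on with
  | H x => exact H x

/-- The lift of a test function on the circle to a (1-periodic) function on the line. -/
def lift (g : SmoothCircle) : ℝ → ℂ := fun x ↦ g (x : UnitAddCircle)

theorem contDiff_lift (g : SmoothCircle) : ContDiff ℝ ∞ g.lift := g.2

theorem periodic_iteratedDeriv_lift (g : SmoothCircle) (k : ℕ) :
    Function.Periodic (iteratedDeriv k g.lift) 1 := by
  induction k with
  | zero =>
    intro x
    simp [lift]
  | succ k ih =>
    intro x
    rw [iteratedDeriv_succ, ← deriv_comp_add_const]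
    congr 1
    exact funext ih

theorem bddAbove_iteratedDeriv_lift (g : SmoothCircle) (k : ℕ) :
    BddAbove (Set.range fun x : ℝ ↦ ‖iteratedDeriv k g.lift x‖) := by
  have hc : Continuous (iteratedDeriv k g.lift) :=
    g.contDiff_lift.continuous_iteratedDeriv k (by exact_mod_cast le_top)
  obtain ⟨C, hC⟩ := (isCompact_Icc (a := (0 : ℝ)) (b := 1)).exists_bound_of_continuousOn
    hc.continuousOn
  refine ⟨C, ?_⟩
  rintro _ ⟨x, rfl⟩
  obtain ⟨y, hy, hxy⟩ := (g.periodic_iteratedDeriv_lift k).exists_mem_Ico₀ one_pos x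
  simp only [hxy]
  exact hC y ⟨hy.1, hy.2.le⟩

/-- The seminorm `g ↦ sup_x |g^{(k)}(x)|` on `C^∞(𝕊¹)`. -/
noncomputable def derivSeminorm (k : ℕ) : Seminorm ℂ SmoothCircle :=
  Seminorm.of (fun g ↦ ⨆ x : ℝ, ‖iteratedDeriv k g.lift x‖)
    (by
      intro g h
      refine ciSup_le fun x ↦ ?_
      have e : iteratedDeriv k (g + h).lift x
          = iteratedDeriv k g.lift x + iteratedDeriv k h.lift x :=
        iteratedDeriv_add
          (g.contDiff_lift.contDiffAt.of_le (by exact_mod_cast le_top))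
          (h.contDiff_lift.contDiffAt.of_le (by exact_mod_cast le_top))
      rw [e]
      exact (norm_add_le _ _).trans (add_le_add
        (le_ciSup (g.bddAbove_iteratedDeriv_lift k) x)
        (le_ciSup (h.bddAbove_iteratedDeriv_lift k) x)))
    (by
      intro c g
      rw [Real.mul_iSup_of_nonneg (norm_nonneg c)]
      congr 1
      funext x
      have e : iteratedDeriv k (c • g).lift x = c • iteratedDeriv k g.lift x :=
        iteratedDeriv_const_smul_field c g.lift
      rw [e, norm_smul])

/-- The Fréchet topology of `C^∞(𝕊¹)`: uniform convergence of all derivatives. -/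
noncomputable instance : TopologicalSpace SmoothCircle :=
  SeminormFamily.moduleFilterBasis (𝕜 := ℂ) derivSeminorm |>.topology

theorem withSeminorms_derivSeminorm : WithSeminorms derivSeminorm := ⟨rfl⟩

/-- The character `x ↦ e^{2πinx}`, as a test function on the circle. -/
noncomputable def char (n : ℤ) : SmoothCircle :=
  ⟨fun z ↦ fourier n z, contDiff_fourier n⟩

end SmoothCircle

/-- The space `𝓢'(𝕊¹)` of distributions on the circle, the topological dual of `C^∞(𝕊¹)`. -/
abbrev CircleDistribution : Type := SmoothCircle →L[ℂ] ℂ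

/-- The Fourier coefficient `f̂(n) = ⟨f, e^{-2πinx}⟩` of a distribution on the circle. -/
noncomputable def circleFourierCoeff (f : CircleDistribution) (n : ℤ) : ℂ :=
  f (SmoothCircle.char (-n))

/-! ### The 1-periodic extension of a distribution on the circle -/

section Periodization

theorem periodic_tsum_schwartz (ψ : 𝓢(ℝ, ℂ)) :
    Function.Periodic (fun x : ℝ ↦ ∑' n : ℤ, ψ (x + n)) 1 := by
  intro x
  simp only
  rw [← (Equiv.addRight (1 : ℤ)).tsum_eq (fun n : ℤ ↦ ψ (x + n))]
  refine tsum_congr fun n ↦ ?_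
  simp only [Equiv.coe_addRight, Int.cast_add, Int.cast_one]
  congr 1
  ring

theorem norm_iteratedDeriv_fourier_term (a : ℂ) (n : ℤ) (k : ℕ) (x : ℝ) :
    ‖iteratedDeriv k (fun y : ℝ ↦ a * fourier n (y : UnitAddCircle)) x‖
      = ‖a‖ * (2 * Real.pi * |(n : ℝ)|) ^ k := by
  have key : iteratedDeriv k (fun y : ℝ ↦ a * fourier n (y : UnitAddCircle))
      = fun y : ℝ ↦ (a * (2 * Real.pi * Complex.I * n) ^ k) *
          fourier n (y : UnitAddCircle) := by
    induction k with
    | zero => simp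
    | succ k ih =>
      rw [iteratedDeriv_succ, ih]
      funext y
      have h := (hasDerivAt_fourier 1 n y).const_mul (a * (2 * Real.pi * Complex.I * n) ^ k)
      rw [h.deriv]
      push_cast
      ring
  rw [key, norm_mul, fourier_apply, Circle.norm_coe]
  simp [abs_of_pos Real.pi_pos]

theorem summable_fourier_bound (k : ℕ) :
    Summable fun n : ℤ ↦ (2 * Real.pi) ^ k * (2 * (1 + |(n : ℝ)| ^ 2)⁻¹) := by
  refine Summable.mul_left _ (Summable.mul_left _ ?_)
  refine Summable.of_nonneg_of_le (fun n ↦ by positivity) (fun n ↦ ?_)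
    (f := fun n : ℤ ↦ if n = 0 then (1 : ℝ) else 1 / (n : ℝ) ^ 2) ?_
  · split_ifs with h
    · simp [h]
    · have : (n : ℝ) ≠ 0 := by exact_mod_cast h
      rw [sq_abs, ← one_div]
      exact one_div_le_one_div_of_le (by positivity) (by linarith)
  · have h1 := (Real.summable_one_div_int_pow (p := 2)).2 (by norm_num)
    refine (summable_congr_cofinite ?_).1 h1
    filter_upwards [(Set.finite_singleton (0 : ℤ)).compl_mem_cofinite] with n hn
    rw [if_neg (by simpa using hn)]

theorem fourier_term_le (h : 𝓢(ℝ, ℂ)) (k : ℕ) (n : ℤ) :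
    ‖h n‖ * (2 * Real.pi * |(n : ℝ)|) ^ k ≤
      (SchwartzMap.seminorm ℂ k 0 h + SchwartzMap.seminorm ℂ (k + 2) 0 h) *
        ((2 * Real.pi) ^ k * (2 * (1 + |(n : ℝ)| ^ 2)⁻¹)) := by
  have h0 := SchwartzMap.norm_pow_mul_le_seminorm ℂ h k (n : ℝ)
  have h2 := SchwartzMap.norm_pow_mul_le_seminorm ℂ h (k + 2) (n : ℝ)
  rw [Real.norm_eq_abs] at h0 h2
  have hA : |(n : ℝ)| ^ k * ‖h n‖ * (1 + |(n : ℝ)| ^ 2) ≤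
      SchwartzMap.seminorm ℂ k 0 h + SchwartzMap.seminorm ℂ (k + 2) 0 h := by
    have e : |(n : ℝ)| ^ k * ‖h n‖ * (1 + |(n : ℝ)| ^ 2)
        = |(n : ℝ)| ^ k * ‖h n‖ + |(n : ℝ)| ^ (k + 2) * ‖h n‖ := by ring
    rw [e]
    exact add_le_add h0 h2
  have hB : |(n : ℝ)| ^ k * ‖h n‖ ≤
      (SchwartzMap.seminorm ℂ k 0 h + SchwartzMap.seminorm ℂ (k + 2) 0 h) *
        (1 + |(n : ℝ)| ^ 2)⁻¹ := by
    rw [← div_eq_mul_inv, le_div_iff₀ (by positivity)]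
    exact hA
  have hS : 0 ≤ (SchwartzMap.seminorm ℂ k 0 h + SchwartzMap.seminorm ℂ (k + 2) 0 h) *
      (1 + |(n : ℝ)| ^ 2)⁻¹ := le_trans (by positivity) hB
  calc ‖h n‖ * (2 * Real.pi * |(n : ℝ)|) ^ k
      = (2 * Real.pi) ^ k * (|(n : ℝ)| ^ k * ‖h n‖) := by rw [mul_pow]; ring
    _ ≤ (2 * Real.pi) ^ k * ((SchwartzMap.seminorm ℂ k 0 h +
          SchwartzMap.seminorm ℂ (k + 2) 0 h) * (1 + |(n : ℝ)| ^ 2)⁻¹ * 2) := by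
        refine mul_le_mul_of_nonneg_left ?_ (by positivity)
        linarith
    _ = _ := by ring

theorem contDiff_fourier_series (h : 𝓢(ℝ, ℂ)) :
    ContDiff ℝ ∞ (fun x : ℝ ↦ ∑' n : ℤ, h n * fourier n (x : UnitAddCircle)) := by
  refine contDiff_tsum (𝕜 := ℝ) (N := ⊤)
    (f := fun (n : ℤ) (x : ℝ) ↦ h n * fourier n (x : UnitAddCircle))
    (v := fun k (n : ℤ) ↦ ‖h n‖ * (2 * Real.pi * |(n : ℝ)|) ^ k)
    (fun n ↦ ?_) (fun k _ ↦ ?_) (fun k n x _ ↦ ?_)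
  · exact contDiff_const.mul (contDiff_fourier n)
  · exact Summable.of_nonneg_of_le (fun n ↦ by positivity) (fun n ↦ fourier_term_le h k n)
      ((summable_fourier_bound k).mul_left _)
  · rw [norm_iteratedFDeriv_eq_norm_iteratedDeriv, norm_iteratedDeriv_fourier_term]

theorem norm_iteratedDeriv_fourier_series_le (h : 𝓢(ℝ, ℂ)) (k : ℕ) (x : ℝ) :
    ‖iteratedDeriv k (fun x : ℝ ↦ ∑' n : ℤ, h n * fourier n (x : UnitAddCircle)) x‖ ≤
      (SchwartzMap.seminorm ℂ k 0 h + SchwartzMap.seminorm ℂ (k + 2) 0 h) *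
        ∑' n : ℤ, (2 * Real.pi) ^ k * (2 * (1 + |(n : ℝ)| ^ 2)⁻¹) := by
  have hs : ∀ k : ℕ, Summable fun n : ℤ ↦ ‖h n‖ * (2 * Real.pi * |(n : ℝ)|) ^ k :=
    fun k ↦ Summable.of_nonneg_of_le (fun n ↦ by positivity) (fun n ↦ fourier_term_le h k n)
      ((summable_fourier_bound k).mul_left _)
  have hd := iteratedFDeriv_tsum (𝕜 := ℝ) (N := ⊤)
      (f := fun (n : ℤ) (x : ℝ) ↦ h n * fourier n (x : UnitAddCircle))
      (v := fun k (n : ℤ) ↦ ‖h n‖ * (2 * Real.pi * |(n : ℝ)|) ^ k)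
      (fun n ↦ contDiff_const.mul (contDiff_fourier n)) (fun k _ ↦ hs k)
      (fun k n x _ ↦ by
        rw [norm_iteratedFDeriv_eq_norm_iteratedDeriv, norm_iteratedDeriv_fourier_term])
      (k := k) le_top
  rw [← norm_iteratedFDeriv_eq_norm_iteratedDeriv, hd, ← tsum_mul_left]
  refine tsum_of_norm_bounded ((summable_fourier_bound k).mul_left _).hasSum (fun n ↦ ?_)
  rw [norm_iteratedFDeriv_eq_norm_iteratedDeriv, norm_iteratedDeriv_fourier_term]
  exact fourier_term_le h k n

theorem tsum_schwartz_eq (ψ : 𝓢(ℝ, ℂ)) :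
    (fun x : ℝ ↦ ∑' n : ℤ, ψ (x + n)) =
      fun x : ℝ ↦ ∑' n : ℤ, (𝓕 ψ) n * fourier n (x : UnitAddCircle) :=
  funext fun x ↦ SchwartzMap.tsum_eq_tsum_fourier ψ x

theorem contDiff_tsum_schwartz (ψ : 𝓢(ℝ, ℂ)) :
    ContDiff ℝ ∞ (fun x : ℝ ↦ ∑' n : ℤ, ψ (x + n)) := by
  rw [tsum_schwartz_eq]
  exact contDiff_fourier_series (𝓕 ψ)

theorem norm_iteratedDeriv_tsum_schwartz_le (ψ : 𝓢(ℝ, ℂ)) (k : ℕ) (x : ℝ) :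
    ‖iteratedDeriv k (fun x : ℝ ↦ ∑' n : ℤ, ψ (x + n)) x‖ ≤
      (SchwartzMap.seminorm ℂ k 0 (𝓕 ψ) + SchwartzMap.seminorm ℂ (k + 2) 0 (𝓕 ψ)) *
        ∑' n : ℤ, (2 * Real.pi) ^ k * (2 * (1 + |(n : ℝ)| ^ 2)⁻¹) := by
  rw [tsum_schwartz_eq]
  exact norm_iteratedDeriv_fourier_series_le (𝓕 ψ) k x

/-- The periodization `x ↦ ∑ₙ ψ(x + n)` of a Schwartz function, as a test function on the
circle. -/
noncomputable def periodize (ψ : 𝓢(ℝ, ℂ)) : SmoothCircle :=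
  ⟨(periodic_tsum_schwartz ψ).lift, contDiff_tsum_schwartz ψ⟩

theorem periodize_coe (ψ : 𝓢(ℝ, ℂ)) (x : ℝ) :
    periodize ψ (x : UnitAddCircle) = ∑' n : ℤ, ψ (x + n) := rfl

theorem summable_schwartz_translates (ψ : 𝓢(ℝ, ℂ)) (x : ℝ) :
    Summable fun n : ℤ ↦ ψ (x + n) := by
  refine Summable.of_norm (Summable.of_nonneg_of_le (fun n ↦ norm_nonneg _) (fun n ↦ ?_)
    ((summable_fourier_bound 0).mul_left
      (SchwartzMap.seminorm ℂ 0 0 (SchwartzMap.compSubConstCLM ℂ (-x) ψ) +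
        SchwartzMap.seminorm ℂ (0 + 2) 0 (SchwartzMap.compSubConstCLM ℂ (-x) ψ))))
  have := fourier_term_le (SchwartzMap.compSubConstCLM ℂ (-x) ψ) 0 n
  simpa [add_comm] using this

/-- Periodization as a linear map. -/
noncomputable def periodizeLM : 𝓢(ℝ, ℂ) →ₗ[ℂ] SmoothCircle where
  toFun := periodize
  map_add' ψ χ := SmoothCircle.ext_fun fun x ↦
    (summable_schwartz_translates ψ x).tsum_add (summable_schwartz_translates χ x)
  map_smul' c ψ := SmoothCircle.ext_fun fun x ↦
    (summable_schwartz_translates ψ x).tsum_const_smul c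

theorem continuous_periodizeLM : Continuous periodizeLM := by
  refine SmoothCircle.withSeminorms_derivSeminorm.continuous_of_continuous_comp periodizeLM
    fun k ↦ Seminorm.continuous_of_continuousAt_zero ?_
  set C : ℝ := ∑' n : ℤ, (2 * Real.pi) ^ k * (2 * (1 + |(n : ℝ)| ^ 2)⁻¹)
  have hb : ∀ ψ : 𝓢(ℝ, ℂ), (SmoothCircle.derivSeminorm k).comp periodizeLM ψ ≤
      (SchwartzMap.seminorm ℂ k 0 (𝓕 ψ) + SchwartzMap.seminorm ℂ (k + 2) 0 (𝓕 ψ)) * C :=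
    fun ψ ↦ ciSup_le fun x ↦ norm_iteratedDeriv_tsum_schwartz_le ψ k x
  have hF : Continuous fun ψ : 𝓢(ℝ, ℂ) ↦ 𝓕 ψ :=
    (FourierTransform.fourierCLM ℂ 𝓢(ℝ, ℂ)).continuous
  have hs : ∀ m : ℕ, Continuous fun ψ : 𝓢(ℝ, ℂ) ↦ SchwartzMap.seminorm ℂ m 0 (𝓕 ψ) :=
    fun m ↦ ((schwartz_withSeminorms ℂ ℝ ℂ).continuous_seminorm (m, 0)).comp hF
  have hc : Continuous fun ψ : 𝓢(ℝ, ℂ) ↦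
      (SchwartzMap.seminorm ℂ k 0 (𝓕 ψ) + SchwartzMap.seminorm ℂ (k + 2) 0 (𝓕 ψ)) * C :=
    ((hs k).add (hs (k + 2))).mul continuous_const
  have h0 : 𝓕 (0 : 𝓢(ℝ, ℂ)) = 0 := (FourierTransform.fourierCLM ℂ 𝓢(ℝ, ℂ)).map_zero
  have ht := hc.tendsto 0
  simp only [h0, map_zero, add_zero, zero_mul] at ht
  rw [ContinuousAt, map_zero]
  exact squeeze_zero (fun ψ ↦ apply_nonneg _ _) hb ht

/-- Periodization as a continuous linear map from `𝓢(ℝ)` to `C^∞(𝕊¹)`. -/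
noncomputable def periodizeCLM : 𝓢(ℝ, ℂ) →L[ℂ] SmoothCircle :=
  ⟨periodizeLM, continuous_periodizeLM⟩

end Periodization

/-- The 1-periodic extension `f^per ∈ 𝓢'(ℝ)` of a distribution `f` on the circle, that is, the
pull-back of `f` along the projection `ℝ → ℝ / ℤ`: `⟨f^per, ψ⟩ = ⟨f, ∑ₙ ψ(· + n)⟩`. The two
theorems that follow say that it is 1-periodic and that it agrees with `f` on every open interval
of length one. -/
noncomputable def periodicExtension (f : CircleDistribution) : 𝓢'(ℝ, ℂ) :=
  ContinuousLinearMap.toPointwiseConvergenceCLM _ _ _ _ (f ∘L periodizeCLM)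

theorem periodicExtension_apply (f : CircleDistribution) (ψ : 𝓢(ℝ, ℂ)) :
    periodicExtension f ψ = f (periodize ψ) := rfl

theorem periodicExtension_translate (f : CircleDistribution) (ψ : 𝓢(ℝ, ℂ)) :
    periodicExtension f (SchwartzMap.compSubConstCLM ℂ 1 ψ) = periodicExtension f ψ := by
  simp only [periodicExtension_apply]
  congr 1
  refine SmoothCircle.ext_fun fun x ↦ ?_
  rw [periodize_coe, periodize_coe, ← (Equiv.addRight (1 : ℤ)).tsum_eq]
  refine tsum_congr fun n ↦ ?_
  simp only [Equiv.coe_addRight, SchwartzMap.compSubConstCLM_apply]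
  congr 1
  push_cast
  ring

theorem periodicExtension_eq_of_support (f : CircleDistribution) (a : ℝ) (ψ : 𝓢(ℝ, ℂ))
    (hψ : Function.support ψ ⊆ Set.Ioo a (a + 1)) (g : SmoothCircle)
    (hg : ∀ x ∈ Set.Ico a (a + 1), g (x : UnitAddCircle) = ψ x) :
    periodicExtension f ψ = f g := by
  rw [periodicExtension_apply]
  congr 1
  refine SmoothCircle.ext_fun fun x ↦ ?_
  obtain ⟨m, hm, -⟩ := existsUnique_add_zsmul_mem_Ico (one_pos : (0 : ℝ) < 1) x a
  rw [zsmul_one] at hm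
  have hx : ((x + (m : ℝ) : ℝ) : UnitAddCircle) = (x : UnitAddCircle) := by
    simp
  rw [periodize_coe, tsum_eq_single m, ← hg _ hm, hx]
  intro n hn
  by_contra h
  have h1 := hψ h
  have h2 : (n : ℝ) < m + 1 := by linarith [h1.2, hm.1]
  have h3 : (m : ℝ) < n + 1 := by linarith [h1.1, hm.2]
  have h2' : n < m + 1 := by exact_mod_cast h2
  have h3' : m < n + 1 := by exact_mod_cast h3
  omega

/-! ### Dyadic resolutions of unity and Besov spaces -/

/-- `φ₀` generates a dyadic resolution of unity: `φ₀ ∈ 𝓢(ℝ)` is real valued, equal to `1` on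
`|x| ≤ 1` and to `0` on `|x| ≥ 3/2`. -/
structure IsDyadicGenerator (φ₀ : 𝓢(ℝ, ℝ)) : Prop where
  eq_one : ∀ x : ℝ, |x| ≤ 1 → φ₀ x = 1
  eq_zero : ∀ x : ℝ, 3 / 2 ≤ |x| → φ₀ x = 0

/-- The dyadic resolution of unity generated by `φ₀`: `φ₀` itself for `j = 0`, and
`φ_j(x) = φ₀(2^{-j} x) - φ₀(2^{-j+1} x)` for `j ≥ 1`. -/
noncomputable def dyadicResolution (φ₀ : 𝓢(ℝ, ℝ)) (j : ℕ) (x : ℝ) : ℝ :=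
  if j = 0 then φ₀ x
  else φ₀ ((2 : ℝ) ^ (-(j : ℤ)) * x) - φ₀ ((2 : ℝ) ^ (-(j : ℤ) + 1) * x)

theorem hasTemperateGrowth_schwartz_scale (φ₀ : 𝓢(ℝ, ℝ)) (c : ℝ) :
    (fun x : ℝ ↦ φ₀ (c * x)).HasTemperateGrowth := by
  have h : (fun x : ℝ ↦ c * x).HasTemperateGrowth := by fun_prop
  exact φ₀.hasTemperateGrowth.comp h

/-- The functions `φ_j` are admissible multipliers of tempered distributions, so that
`TemperedDistribution.smulLeftCLM` below is the actual multiplication by `φ_j`. -/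
theorem hasTemperateGrowth_dyadicResolution (φ₀ : 𝓢(ℝ, ℝ)) (j : ℕ) :
    (fun ξ : ℝ ↦ (dyadicResolution φ₀ j ξ : ℂ)).HasTemperateGrowth := by
  have h : (dyadicResolution φ₀ j).HasTemperateGrowth := by
    unfold dyadicResolution
    split_ifs with hj
    · exact φ₀.hasTemperateGrowth
    · exact (hasTemperateGrowth_schwartz_scale φ₀ _).sub (hasTemperateGrowth_schwartz_scale φ₀ _)
  exact Function.Complex.hasTemperateGrowth_ofReal.comp h

/-- The dyadic block `(φ_j F̂)^∨` of a tempered distribution `F` on the line. -/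
noncomputable def dyadicBlock (φ₀ : 𝓢(ℝ, ℝ)) (j : ℕ) (F : 𝓢'(ℝ, ℂ)) : 𝓢'(ℝ, ℂ) :=
  𝓕⁻ (TemperedDistribution.smulLeftCLM ℂ (fun ξ : ℝ ↦ (dyadicResolution φ₀ j ξ : ℂ)) (𝓕 F))

/-- The essential supremum `ess sup |T(x)| ∈ [0, ∞]` of a tempered distribution `T`: it is
`ess sup |g(x)|` if `T` is given by a (necessarily unique) `g ∈ L^∞(ℝ)`, and `∞` if there is no
such `g`. -/
noncomputable def distributionEssSup (T : 𝓢'(ℝ, ℂ)) : ℝ≥0∞ :=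
  ⨅ (g : Lp ℂ ⊤ (volume : Measure ℝ)) (_ : Lp.toTemperedDistribution g = T),
    essSup (fun x : ℝ ↦ ‖g x‖ₑ) volume

/-- The quasi-norm `‖F‖_{∞,∞,φ,s} = sup_{j ≥ 0} 2^{js} ess sup_x |(φ_j F̂)^∨(x)|`, with values in
`[0, ∞]`, of a tempered distribution on the line. -/
noncomputable def besovNormLine (φ₀ : 𝓢(ℝ, ℝ)) (s : ℝ) (F : 𝓢'(ℝ, ℂ)) : ℝ≥0∞ :=
  ⨆ j : ℕ, ENNReal.ofReal ((2 : ℝ) ^ ((j : ℝ) * s)) * distributionEssSup (dyadicBlock φ₀ j F)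

/-- The Besov space `B^s_{∞,∞}(ℝ)`. -/
def besovSpaceLine (φ₀ : 𝓢(ℝ, ℝ)) (s : ℝ) : Set 𝓢'(ℝ, ℂ) :=
  {F | besovNormLine φ₀ s F < ⊤}

/-- The quasi-norm `sup_{j ≥ 0} 2^{js} ess sup_x |∑ₙ φ_j(n) f̂(n) e^{2πinx}|`, with values in
`[0, ∞]`, of a distribution on the circle. The sum over `n` has finitely many non-zero terms. -/
noncomputable def besovNormCircle (φ₀ : 𝓢(ℝ, ℝ)) (s : ℝ) (f : CircleDistribution) : ℝ≥0∞ :=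
  ⨆ j : ℕ, ENNReal.ofReal ((2 : ℝ) ^ ((j : ℝ) * s)) *
    essSup (fun x : ℝ ↦ ‖∑' n : ℤ, (dyadicResolution φ₀ j (n : ℝ) : ℂ) *
      circleFourierCoeff f n * fourier n (x : UnitAddCircle)‖ₑ) volume

/-- The Besov space `B^s_{∞,∞}(𝕊¹)`. -/
def besovSpaceCircle (φ₀ : 𝓢(ℝ, ℝ)) (s : ℝ) : Set CircleDistribution :=
  {f | besovNormCircle φ₀ s f < ⊤}

/-! The two norms agree block by block. Moving `𝓕⁻`, the multiplier and `𝓕` onto the test function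
`ψ`, the `j`-th block of `f^PER` sends `ψ` to `f` applied to the periodization of `𝓕 χ`, where `χ =
φ_j · 𝓕⁻ψ`. By Poisson summation this periodization is `∑ₙ χ(n) e^{-2πinx}`, a finite sum because
`φ_j` has bounded support (`periodize_fourier_eq_sum`). Linearity of `f` then gives `∑ₙ φ_j(n) f̂(n)
(𝓕⁻ψ)(n)`, which is the integral of `ψ` against the `j`-th trigonometric polynomial of `f`
(`dyadicBlock_periodicExtension_apply`). So the block is that bounded function, and since a bounded
function is determined by its distribution, the essential suprema coincide
(`distributionEssSup_eq_essSup`). -/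

/-- Evaluation at a point of the circle, as a linear map. -/
noncomputable def SmoothCircle.evalLM (z : UnitAddCircle) : SmoothCircle →ₗ[ℂ] ℂ :=
  LinearMap.proj z ∘ₗ smoothCircleSubmodule.subtype

theorem SmoothCircle.sum_smul_apply {ι : Type*} (S : Finset ι) (c : ι → ℂ)
    (g : ι → SmoothCircle) (z : UnitAddCircle) :
    (∑ i ∈ S, c i • g i) z = ∑ i ∈ S, c i * g i z := by
  change SmoothCircle.evalLM z (∑ i ∈ S, c i • g i) = _
  rw [map_sum]
  exact Finset.sum_congr rfl fun i _ ↦ (SmoothCircle.evalLM z).map_smul (c i) (g i)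

/-- This is Fourier inversion at `-x`, because `𝓕` is `𝓕⁻` followed by reflection. -/
theorem SchwartzMap.fourier_fourier_apply (χ : 𝓢(ℝ, ℂ)) (x : ℝ) : (𝓕 (𝓕 χ)) x = χ (-x) := by
  have h : (𝓕⁻ (𝓕 χ)) (-x) = χ (-x) := by rw [FourierTransform.fourierInv_fourier_eq]
  rw [← h, SchwartzMap.fourierInv_coe, Real.fourierInv_eq_fourier_neg, neg_neg,
    SchwartzMap.fourier_coe]

/-- The periodization of the Fourier transform of `χ` is a trigonometric polynomial if only
finitely many of the values `χ n` are non-zero. -/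
theorem periodize_fourier_eq_sum (χ : 𝓢(ℝ, ℂ)) (S : Finset ℤ) (hS : ∀ n : ℤ, n ∉ S → χ n = 0) :
    periodize (𝓕 χ) = ∑ n ∈ S, χ n • SmoothCircle.char (-n) := by
  refine SmoothCircle.ext_fun fun x ↦ ?_
  -- Poisson summation produces the coefficients `(𝓕 (𝓕 χ)) n = χ (-n)`; the reindexing `n ↦ -n`
  -- turns them into `χ n` and the characters into `char (-n)`.
  rw [SmoothCircle.sum_smul_apply, periodize_coe, SchwartzMap.tsum_eq_tsum_fourier,
    ← (Equiv.neg ℤ).tsum_eq, tsum_eq_sum (s := S)]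
  · refine Finset.sum_congr rfl fun n _ ↦ ?_
    rw [SchwartzMap.fourier_fourier_apply]
    simp [SmoothCircle.char]
  · intro n hn
    rw [SchwartzMap.fourier_fourier_apply]
    simp [hS n hn]

/-- The wider of the two dilates vanishes once `|x| ≥ (3/2) 2^j`; the cruder threshold `2^(j+1)` is
an integer and serves `j = 0` as well. -/
theorem IsDyadicGenerator.dyadicResolution_eq_zero {φ₀ : 𝓢(ℝ, ℝ)} (hφ₀ : IsDyadicGenerator φ₀)
    (j : ℕ) {x : ℝ} (hx : 2 ^ (j + 1) ≤ |x|) : dyadicResolution φ₀ j x = 0 := by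
  have h2 : (0 : ℝ) < 2 ^ j := by positivity
  have hj : (2 : ℝ) ≤ 2 ^ (-(j : ℤ)) * |x| := by
    rw [zpow_neg, zpow_natCast, inv_mul_eq_div, le_div_iff₀ h2]
    rwa [pow_succ, mul_comm] at hx
  unfold dyadicResolution
  split_ifs with h
  · subst h
    refine hφ₀.eq_zero _ ?_
    norm_num at hx
    linarith
  · rw [hφ₀.eq_zero, hφ₀.eq_zero, sub_zero]
    -- This argument is twice the one bounded below in `hj`.
    · rw [zpow_add₀ two_ne_zero, zpow_one, abs_mul, abs_of_pos (by positivity)]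
      linarith
    · rw [abs_mul, abs_of_pos (by positivity)]
      linarith

theorem IsDyadicGenerator.dyadicResolution_intCast_eq_zero {φ₀ : 𝓢(ℝ, ℝ)}
    (hφ₀ : IsDyadicGenerator φ₀) (j : ℕ) (n : ℤ)
    (hn : n ∉ Finset.Icc (-2 ^ (j + 1) : ℤ) (2 ^ (j + 1))) :
    dyadicResolution φ₀ j n = 0 := by
  refine hφ₀.dyadicResolution_eq_zero j ?_
  have h : (2 ^ (j + 1) : ℤ) ≤ |n| := by
    rw [Finset.mem_Icc, ← abs_le, not_le] at hn
    exact hn.le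
  exact_mod_cast h

/-! ### Dyadic blocks of a periodic extension -/

theorem integrable_schwartz_mul_fourier (ψ : 𝓢(ℝ, ℂ)) (n : ℤ) :
    Integrable fun x : ℝ ↦ ψ x * fourier n (x : UnitAddCircle) := by
  refine ψ.integrable.mul_bdd (c := 1) (contDiff_fourier n).continuous.aestronglyMeasurable ?_
  exact Filter.Eventually.of_forall fun x ↦ by rw [fourier_apply, Circle.norm_coe]

theorem SchwartzMap.fourierInv_intCast (ψ : 𝓢(ℝ, ℂ)) (n : ℤ) :
    (𝓕⁻ ψ) n = ∫ x : ℝ, ψ x * fourier n (x : UnitAddCircle) := by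
  rw [SchwartzMap.fourierInv_coe, Real.fourierInv_eq']
  refine integral_congr_ae (Filter.Eventually.of_forall fun x ↦ ?_)
  simp only [fourier_coe_apply, smul_eq_mul]
  rw [mul_comm]
  congr 2
  simp
  ring

/-- All three operations on `𝓢'(ℝ)` are defined by transposition, so they reach `ψ` in reverse
order. -/
theorem dyadicBlock_apply (φ₀ : 𝓢(ℝ, ℝ)) (j : ℕ) (F : 𝓢'(ℝ, ℂ)) (ψ : 𝓢(ℝ, ℂ)) :
    dyadicBlock φ₀ j F ψ = F (𝓕 (SchwartzMap.smulLeftCLM ℂ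
      (fun ξ : ℝ ↦ (dyadicResolution φ₀ j ξ : ℂ)) (𝓕⁻ ψ))) := rfl

/-- The dyadic block of a periodic extension is given by integration against the corresponding
trigonometric polynomial. -/
theorem IsDyadicGenerator.dyadicBlock_periodicExtension_apply {φ₀ : 𝓢(ℝ, ℝ)}
    (hφ₀ : IsDyadicGenerator φ₀) (j : ℕ) (f : CircleDistribution) (ψ : 𝓢(ℝ, ℂ)) :
    dyadicBlock φ₀ j (periodicExtension f) ψ =
      ∫ x : ℝ, ψ x * ∑' n : ℤ, (dyadicResolution φ₀ j (n : ℝ) : ℂ) *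
        circleFourierCoeff f n * fourier n (x : UnitAddCircle) := by
  set S : Finset ℤ := Finset.Icc (-2 ^ (j + 1)) (2 ^ (j + 1))
  have hS : ∀ n : ℤ, n ∉ S → dyadicResolution φ₀ j n = 0 :=
    hφ₀.dyadicResolution_intCast_eq_zero j
  have hg := hasTemperateGrowth_dyadicResolution φ₀ j
  rw [dyadicBlock_apply, periodicExtension_apply, periodize_fourier_eq_sum _ S]
  · have h (x : ℝ) : ψ x * ∑' n : ℤ, (dyadicResolution φ₀ j (n : ℝ) : ℂ) *
        circleFourierCoeff f n * fourier n (x : UnitAddCircle) =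
        ∑ n ∈ S, ((dyadicResolution φ₀ j (n : ℝ) : ℂ) * circleFourierCoeff f n) *
          (ψ x * fourier n (x : UnitAddCircle)) := by
      rw [tsum_eq_sum (s := S) fun n hn ↦ by simp [hS n hn], Finset.mul_sum]
      exact Finset.sum_congr rfl fun n _ ↦ by ring
    simp only [h]
    -- Both sides are now finite sums over `S`, and each term equals `φ_j(n) f̂(n) (𝓕⁻ψ)(n)`.
    rw [integral_finsetSum _ fun n _ ↦ (integrable_schwartz_mul_fourier ψ n).const_mul _, map_sum]
    refine Finset.sum_congr rfl fun n _ ↦ ?_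
    rw [map_smul, SchwartzMap.smulLeftCLM_apply_apply hg, integral_const_mul,
      SchwartzMap.fourierInv_intCast, circleFourierCoeff]
    simp only [smul_eq_mul]
    ring
  · intro n hn
    rw [SchwartzMap.smulLeftCLM_apply_apply hg, hS n hn]
    simp

/-! ### Essential suprema of the blocks -/

theorem IsDyadicGenerator.memLp_top_trigPolynomial {φ₀ : 𝓢(ℝ, ℝ)} (hφ₀ : IsDyadicGenerator φ₀)
    (j : ℕ) (a : ℤ → ℂ) :
    MemLp (fun x : ℝ ↦ ∑' n : ℤ, (dyadicResolution φ₀ j (n : ℝ) : ℂ) * a n *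
      fourier n (x : UnitAddCircle)) ⊤ volume := by
  have h : (fun x : ℝ ↦ ∑' n : ℤ, (dyadicResolution φ₀ j (n : ℝ) : ℂ) * a n *
      fourier n (x : UnitAddCircle)) = fun x : ℝ ↦
        ∑ n ∈ Finset.Icc (-2 ^ (j + 1) : ℤ) (2 ^ (j + 1)),
          (dyadicResolution φ₀ j (n : ℝ) : ℂ) * a n * fourier n (x : UnitAddCircle) := by
    funext x
    exact tsum_eq_sum fun n hn ↦ by simp [hφ₀.dyadicResolution_intCast_eq_zero j n hn]
  rw [h]
  refine memLp_finsetSum _ fun n _ ↦ MemLp.const_mul ?_ _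
  refine memLp_top_of_bound (contDiff_fourier n).continuous.aestronglyMeasurable 1 ?_
  exact Filter.Eventually.of_forall fun x ↦ by rw [fourier_apply, Circle.norm_coe]

/-- Guarantees that the infimum in `distributionEssSup` runs over at most one `g`. -/
theorem toTemperedDistribution_injective_top :
    Function.Injective fun g : Lp ℂ ⊤ (volume : Measure ℝ) ↦ Lp.toTemperedDistribution g := by
  have h := LinearMap.ker_eq_bot.1
    (Lp.ker_toTemperedDistributionCLM_eq_bot (F := ℂ) (μ := (volume : Measure ℝ)) (p := ⊤))
  exact h

/-- The essential supremum of the distribution given by a bounded function is that of the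
function. -/
theorem distributionEssSup_eq_essSup {T : 𝓢'(ℝ, ℂ)} {u : ℝ → ℂ} (hu : MemLp u ⊤ volume)
    (hT : ∀ ψ : 𝓢(ℝ, ℂ), T ψ = ∫ x : ℝ, ψ x * u x) :
    distributionEssSup T = essSup (fun x : ℝ ↦ ‖u x‖ₑ) volume := by
  have hTu : Lp.toTemperedDistribution (hu.toLp u) = T := by
    ext ψ
    rw [Lp.toTemperedDistribution_apply, hT]
    refine integral_congr_ae ?_
    filter_upwards [hu.coeFn_toLp] with x hx
    rw [hx, smul_eq_mul]
  have hess : essSup (fun x : ℝ ↦ ‖hu.toLp u x‖ₑ) volume = essSup (fun x : ℝ ↦ ‖u x‖ₑ) volume := by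
    refine essSup_congr_ae ?_
    filter_upwards [hu.coeFn_toLp] with x hx
    rw [hx]
  rw [← hess]
  -- The class of `u` is one competitor in the infimum, and by injectivity any other competitor
  -- equals it.
  refine le_antisymm (iInf₂_le (hu.toLp u) hTu) (le_iInf₂ fun g hg ↦ ?_)
  rw [toTemperedDistribution_injective_top (hg.trans hTu.symm)]

theorem mainTheorem3 (φ₀ : 𝓢(ℝ, ℝ)) (hφ₀ : IsDyadicGenerator φ₀) (s : ℝ)
    (f : CircleDistribution) :
    besovNormLine φ₀ s (periodicExtension f) = besovNormCircle φ₀ s f ∧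
      (periodicExtension f ∈ besovSpaceLine φ₀ s ↔ f ∈ besovSpaceCircle φ₀ s) := by
  have h : besovNormLine φ₀ s (periodicExtension f) = besovNormCircle φ₀ s f := by
    unfold besovNormLine besovNormCircle
    -- The weights `2^{js}` are the same on both sides, so it suffices to compare the essential
    -- suprema for each `j`.
    refine iSup_congr fun j ↦ ?_
    rw [distributionEssSup_eq_essSup (hφ₀.memLp_top_trigPolynomial j (circleFourierCoeff f))
      (hφ₀.dyadicBlock_periodicExtension_apply j f)]
  refine ⟨h, ?_⟩
  simp only [besovSpaceLine, besovSpaceCircle, Set.mem_ofPred_eq, h]
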